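/- Let $E$ be a site with finite products (a topos) and let $(U_i)_{i\in I}$ be a family of objects of $E$ covering the final object; write $U_{i_1\ldots i_k}=U_{i_1}\times\cdots\times U_{i_k}$. Let $F_n\to F_{n-1}\to\cdots\to F_1\to E$ be an $n$-gerbed tower bounded by sheaves of commutative groups $L_1,\ldots,L_n$ on $E$. That is: each $F_l$ is a $2$-category over $E$ with strictly functorial restriction functors commuting with the projections $p_{l+1}:F_{l+1}\to F_l$, each object of $F_l$ is endowed with a topos on which the $2$-arrows, all invertible, act by continuous maps; $F_1$ is a gerbe on $E$ bounded by $L_1$; the fibre of $F_{l+1}$ over an object $X$ of $F_l$ lying over $V\in E$ is (the category of global objects of) a gerbe on the topos $X$, bounded by a sheaf induced by $L_{l+1}$ with global sections $L_{l+1}(V)$; and every $2$-arrow of $F_l$ lifts to a $2$-arrow of $F_{l+1}$ with given target. Suppose moreover that there are sheaves of commutative groups $L'_2,\ldots,L'_n$ on $E$ such that, for every object $Y$ of $F_{l+1}$ over $X\in F_l$ over $V\in E$, $L'_{l+1}(V)$ is identified with the group of automorphisms of $Y$ whose image in $\mathrm{Aut}(X)$ lies in $L_l(V)$, compatibly with restrictions,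 with the inclusion $L_{l+1}\to L'_{l+1}$ and with the projection $L'_{l+1}\to L_l$. The classifying cochains are defined inductively. Choose objects $u_i$ of $F_1$ over $U_i$ and isomorphisms $v_{i_1i_2}$ from the restriction of $u_{i_2}$ to the restriction of $u_{i_1}$ over $U_{i_1i_2}$, and let $c_{i_1i_2i_3}=v_{i_3i_1}v_{i_1i_2}v_{i_2i_3}\in L_1(U_{i_1i_2i_3})$, an automorphism of the restriction of $u_{i_3}$. Given $c_{i_1\ldots i_{l+2}}\in L_l(U_{i_1\ldots i_{l+2}})$, acting on an object $X_{i_1\ldots i_{l+2}}$ of $F_l$ over $U_{i_1\ldots i_{l+2}}$, choose objects $u_{i_1\ldots i_{l+2}}$ of $F_{l+1}$ above $X_{i_1\ldots i_{l+2}}$ and automorphisms $c^*_{i_1\ldots i_{l+2}}\in L'_{l+1}(U_{i_1\ldots i_{l+2}})$ of $u_{i_1\ldots i_{l+2}}$ above $c_{i_1\ldots i_{l+2}}$; the next cochain is $$c_{i_1\ldots i_{l+3}}=\sum_{p=1}^{l+3}(-1)^p\,c^*_{i_1\ldots\hat{i_p}\ldots i_{l+3}}$$ (the restrictions to $U_{i_1\ldots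 i_{l+3}}$ being understood, and with the opposite global sign when $l=1$), whenever it belongs to $L_{l+1}(U_{i_1\ldots i_{l+3}})$; it acts on the restriction of $u_{i_1\ldots i_{l+2}}$, which is the new object $X_{i_1\ldots i_{l+3}}$ of $F_{l+1}$. Let $2\le l<n$, suppose that the classifying cochains $c_{i_1i_2i_3},\ldots,c_{i_1\ldots i_{l+2}}$ are defined, and let $u_{i_1\ldots i_{l+2}}$ and $c^*_{i_1\ldots i_{l+2}}$ be any choices as above. Then the alternating sums $c_{i_1\ldots i_{l+3}}$ define the same automorphisms of the restrictions of the $u_{i_1\ldots i_{l+2}}$ as a unique family of sections of $L_{l+1}$ over the $U_{i_1\ldots i_{l+3}}$, and this family is a Čech cocycle of the family $(U_i)$ with values in $L_{l+1}$ (of degree $l+2$). -/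

import Mathlib

open CategoryTheory CategoryTheory.Limits CategoryTheory.Bicategory Opposite

universe u v w₁ w₂ t₁ t₂ g₁ g₂ a

namespace GerbedTowers

/-! ### Gerbes -/

section Gerbe

variable {C : Type u} [Category.{v} C]

/-- The restriction functor `G(U) ⥤ G(V)` attached to an arrow `f : V ⟶ U`. -/
abbrev pres (G : LocallyDiscrete Cᵒᵖ ⥤ᵖ Cat.{g₁, g₂}) {V U : C} (f : V ⟶ U) :
    G.obj ⟨op U⟩ ⥤ G.obj ⟨op V⟩ :=
  (G.map f.op.toLoc).toFunctor

/-- `G` is a gerbe on the site `(C, J)`: a sheaf of categories (arrows and objects glue) whose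
arrows are invertible, which locally has objects, and any two objects of which are locally
isomorphic. -/
structure IsGerbe (J : GrothendieckTopology C) (G : LocallyDiscrete Cᵒᵖ ⥤ᵖ Cat.{g₁, g₂}) :
    Prop where
  isStack : G.IsStack J
  isGroupoid : ∀ U : C, IsGroupoid (G.obj ⟨op U⟩)
  locallyNonempty : ∀ U : C, ∃ S ∈ J U, ∀ ⦃V : C⦄ (f : V ⟶ U), S f → Nonempty (G.obj ⟨op V⟩)
  locallyConnected : ∀ (U : C) (x y : G.obj ⟨op U⟩), ∃ S ∈ J U, ∀ ⦃V : C⦄ (f : V ⟶ U), S f →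
    Nonempty ((pres G f).obj x ⟶ (pres G f).obj y)

/-- `G` is bounded by the commutative sheaf `L` through `act`: the maps `act U x` are isomorphisms
from `L(U)` to the automorphism group of `x`, and they commute with restrictions and with the
morphisms between objects. -/
structure IsBand {J : GrothendieckTopology C} (G : LocallyDiscrete Cᵒᵖ ⥤ᵖ Cat.{g₁, g₂})
    (L : Sheaf J AddCommGrpCat.{a})
    (act : ∀ (U : C) (x : G.obj ⟨op U⟩), Multiplicative (L.obj.obj (op U)) →* Aut x) :
    Prop where
  bijective : ∀ (U : C) (x : G.obj ⟨op U⟩), Function.Bijective (act U x)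
  map_act : ∀ {V U : C} (f : V ⟶ U) (x : G.obj ⟨op U⟩) (s : L.obj.obj (op U)),
    (pres G f).mapAut x (act U x (Multiplicative.ofAdd s)) =
      act V ((pres G f).obj x) (Multiplicative.ofAdd (L.obj.map f.op s))
  act_comm : ∀ {U : C} {x y : G.obj ⟨op U⟩} (m : x ⟶ y) (s : Multiplicative (L.obj.obj (op U))),
    (act U x s).hom ≫ m = m ≫ (act U y s).hom

end Gerbe

/-! ### 2-categories over the base and their toposes -/

section Levels

variable {E : Type u} [Category.{v} E]

/-- The restriction functor `F_V ⥤ F_W` of a presheaf of categories along `f : W ⟶ V`. -/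
abbrev res (F : Eᵒᵖ ⥤ Cat.{w₁, w₂}) {W V : E} (f : W ⟶ V) : F.obj (op V) ⥤ F.obj (op W) :=
  (F.map f.op).toFunctor

/-- Restrictions along composable arrows compose. -/
theorem res_comp_obj (F : Eᵒᵖ ⥤ Cat.{w₁, w₂}) {V₁ V₂ V₃ : E} (f : V₁ ⟶ V₂) (g : V₂ ⟶ V₃)
    (h : V₁ ⟶ V₃) (e : f ≫ g = h) (X : F.obj (op V₃)) :
    (res F f).obj ((res F g).obj X) = (res F h).obj X := by
  subst e
  simp [res]

/-- The functor induced by `p : F' ⟶ F` between the fibres above `V`. -/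
abbrev proj {F' F : Eᵒᵖ ⥤ Cat.{w₁, w₂}} (p : F' ⟶ F) (V : E) : F'.obj (op V) ⥤ F.obj (op V) :=
  (p.app (op V)).toFunctor

/-- A topology on the 2-category over `E` whose fibres are the categories `F_V` of objects and
2-arrows: every object is endowed with a topos (a site with a final object), and the 2-arrows
between two objects act faithfully by continuous functors between their toposes. -/
structure TwoTopology (F : Eᵒᵖ ⥤ Cat.{w₁, w₂}) where
  /-- the category underlying the topos of an object, and the functor attached to a 2-arrow -/
  topos : ∀ V : E, F.obj (op V) ⥤ Cat.{t₁, t₂}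
  /-- the topology of the topos of an object -/
  top : ∀ (V : E) (X : F.obj (op V)), GrothendieckTopology ((topos V).obj X)
  hasTerminal : ∀ (V : E) (X : F.obj (op V)), HasTerminal ((topos V).obj X)
  continuous : ∀ (V : E) {X Y : F.obj (op V)} (f : X ⟶ Y),
    Functor.IsContinuous ((topos V).map f).toFunctor (top V X) (top V Y)
  faithful : ∀ V : E, (topos V).Faithful

/-- The final object of the topos of the object `X`. -/
noncomputable def TwoTopology.final {F : Eᵒᵖ ⥤ Cat.{w₁, w₂}} (τ : TwoTopology.{u, v, w₁, w₂, t₁, t₂} F)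
    {V : E} (X : F.obj (op V)) : (τ.topos V).obj X :=
  haveI := τ.hasTerminal V X
  ⊤_ ((τ.topos V).obj X)

/-- The structure of a gerbe, bounded by the sheaf induced by `L`, on the fibre of `p : F' ⟶ F`
over an object `X` of `F_V`. -/
structure FibreGerbe {J : GrothendieckTopology E} {F F' : Eᵒᵖ ⥤ Cat.{w₁, w₂}} (p : F' ⟶ F)
    (τ : TwoTopology.{u, v, w₁, w₂, t₁, t₂} F) (L : Sheaf J AddCommGrpCat.{a})
    {V : E} (X : F.obj (op V)) where
  /-- the gerbe on the topos of `X` -/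
  gerbe : LocallyDiscrete ((τ.topos V).obj X)ᵒᵖ ⥤ᵖ Cat.{g₁, g₂}
  isGerbe : IsGerbe (τ.top V X) gerbe
  /-- the sheaf induced by `L` on the topos of `X` -/
  sheaf : Sheaf (τ.top V X) AddCommGrpCat.{a}
  /-- its global sections are those of `L` over the image `V` of `X` in `E` -/
  sections : L.obj.obj (op V) ≃+ sheaf.obj.obj (op (τ.final X))
  /-- the action of the induced sheaf on the objects of the gerbe -/
  act : ∀ (t : (τ.topos V).obj X) (y : gerbe.obj ⟨op t⟩),
    Multiplicative (sheaf.obj.obj (op t)) →* Aut y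
  isBand : IsBand gerbe sheaf act
  /-- the objects of `F'` above `X` are the global objects of the gerbe -/
  fibre : (proj p V).Fiber X ≌ gerbe.obj ⟨op (τ.final X)⟩

/-- The automorphism of an object `Y` of the fibre over `X` defined by a section of `L` over the
image `V` of `X` in `E`. -/
noncomputable def FibreGerbe.aut {J : GrothendieckTopology E} {F F' : Eᵒᵖ ⥤ Cat.{w₁, w₂}}
    {p : F' ⟶ F} {τ : TwoTopology.{u, v, w₁, w₂, t₁, t₂} F} {L : Sheaf J AddCommGrpCat.{a}}
    {V : E} {X : F.obj (op V)}
    (G : FibreGerbe.{u, v, w₁, w₂, t₁, t₂, g₁, g₂, a} p τ L X) (Y : (proj p V).Fiber X)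
    (s : L.obj.obj (op V)) : Aut Y :=
  (G.fibre.fullyFaithfulFunctor.autMulEquivOfFullyFaithful Y).symm
    (G.act (τ.final X) (G.fibre.functor.obj Y) (Multiplicative.ofAdd (G.sections s)))

end Levels

/-! ### Gerbed towers -/

/-- An `n`-gerbed tower `F_n ⟶ ⋯ ⟶ F_1 ⟶ E` over the site `(E, J)`, bounded by commutative sheaves
`L_1, …, L_n`. The 2-category `F_l` is given by its fibres over `E` (objects, and 2-arrows between
objects) and by its strictly functorial restriction functors, that is, by a presheaf of categories
on `E`. Only the indices `1 ≤ l ≤ n` are meaningful. -/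
structure GerbedTower {E : Type u} [Category.{v} E] (J : GrothendieckTopology E) (n : ℕ) where
  /-- the 2-categories of the tower -/
  F : ℕ → Eᵒᵖ ⥤ Cat.{w₁, w₂}
  /-- their topologies -/
  topology : ∀ l : ℕ, 1 ≤ l → l ≤ n → TwoTopology.{u, v, w₁, w₂, t₁, t₂} (F l)
  /-- the 2-arrows are invertible -/
  isGroupoid : ∀ l : ℕ, 1 ≤ l → l ≤ n → ∀ V : E, IsGroupoid ((F l).obj (op V))
  /-- the projections; they commute with restrictions -/
  p : ∀ l : ℕ, 1 ≤ l → l < n → (F (l + 1) ⟶ F l)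
  /-- the band -/
  L : ℕ → Sheaf J AddCommGrpCat.{a}
  /-- the sections of the band seen as automorphisms of objects -/
  act : ∀ (l : ℕ) (V : E) (X : (F l).obj (op V)), Multiplicative ((L l).obj.obj (op V)) →* Aut X
  /-- `F_1` is a gerbe on `E` -/
  isGerbe_one : 1 ≤ n → IsGerbe J (F 1).toPseudofunctor'
  /-- `F_1` is bounded by `L_1` -/
  isBand_one : 1 ≤ n → IsBand (F 1).toPseudofunctor' (L 1) (act 1)
  /-- the fibre of `F_{l+1}` over an object of `F_l` is a gerbe bounded by `L_{l+1}` -/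
  fibreGerbe : ∀ (l : ℕ) (h₁ : 1 ≤ l) (h₂ : l < n) (V : E) (X : (F l).obj (op V)),
    FibreGerbe.{u, v, w₁, w₂, t₁, t₂, g₁, g₂, a} (p l h₁ h₂) (topology l h₁ h₂.le) (L (l + 1)) X
  /-- the automorphisms attached to sections of `L_{l+1}` are those given by these gerbes -/
  act_eq : ∀ (l : ℕ) (h₁ : 1 ≤ l) (h₂ : l < n) (V : E) (X : (F l).obj (op V))
    (Y : (proj (p l h₁ h₂) V).Fiber X) (s : (L (l + 1)).obj.obj (op V)),
    act (l + 1) V Y.1 (Multiplicative.ofAdd s) =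
      Functor.Fiber.fiberInclusion.mapAut Y ((fibreGerbe l h₁ h₂ V X).aut Y s)
  /-- they commute with restrictions -/
  map_act : ∀ (l : ℕ), 1 ≤ l → l ≤ n → ∀ {W V : E} (f : W ⟶ V) (X : (F l).obj (op V))
    (s : (L l).obj.obj (op V)),
    (res (F l) f).mapAut X (act l V X (Multiplicative.ofAdd s)) =
      act l W ((res (F l) f).obj X) (Multiplicative.ofAdd ((L l).obj.map f.op s))
  /-- every 2-arrow `X₁ ⟶ X₂` of `F_l` lifts to a 2-arrow of `F_{l+1}` with a given target
  above `X₂` -/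
  exists_lift : ∀ (l : ℕ) (h₁ : 1 ≤ l) (h₂ : l < n) (V : E) {X₁ X₂ : (F l).obj (op V)}
    (m : X₁ ⟶ X₂) (Y₂ : (proj (p l h₁ h₂) V).Fiber X₂),
    ∃ (Y₁ : (proj (p l h₁ h₂) V).Fiber X₁) (m' : Y₁.1 ⟶ Y₂.1),
      (proj (p l h₁ h₂) V).IsHomLift m m'

/-- Commutative sheaves `L'_2, …, L'_n` on `E` such that, for each object `Y` of `F_{l+1}` above an
object `X` of `F_l` above `V`, the group `L'_{l+1}(V)` is the group of the automorphisms of `Y`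
whose image in `Aut X` belongs to `L_l(V)`. The inclusion of `L_{l+1}(V)` in this group and its
projection to `L_l(V)` are the values of morphisms of sheaves. -/
structure ExtendedBand {E : Type u} [Category.{v} E] {J : GrothendieckTopology E} {n : ℕ}
    (T : GerbedTower.{u, v, w₁, w₂, t₁, t₂, g₁, g₂, a} J n) where
  /-- the sheaves `L'_l` -/
  L' : ℕ → Sheaf J AddCommGrpCat.{a}
  /-- their sections seen as automorphisms of objects -/
  act' : ∀ (l : ℕ) (V : E) (Y : (T.F l).obj (op V)),
    Multiplicative ((L' l).obj.obj (op V)) →* Aut Y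
  injective : ∀ l : ℕ, 1 ≤ l → l < n → ∀ (V : E) (Y : (T.F (l + 1)).obj (op V)),
    Function.Injective (act' (l + 1) V Y)
  mem_range_iff : ∀ (l : ℕ) (h₁ : 1 ≤ l) (h₂ : l < n) (V : E) (Y : (T.F (l + 1)).obj (op V))
    (b : Aut Y), b ∈ (act' (l + 1) V Y).range ↔
      (proj (T.p l h₁ h₂) V).mapAut Y b ∈ (T.act l V ((proj (T.p l h₁ h₂) V).obj Y)).range
  map_act' : ∀ l : ℕ, 1 ≤ l → l < n → ∀ {W V : E} (f : W ⟶ V) (Y : (T.F (l + 1)).obj (op V))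
    (s : (L' (l + 1)).obj.obj (op V)),
    (res (T.F (l + 1)) f).mapAut Y (act' (l + 1) V Y (Multiplicative.ofAdd s)) =
      act' (l + 1) W ((res (T.F (l + 1)) f).obj Y)
        (Multiplicative.ofAdd ((L' (l + 1)).obj.map f.op s))
  /-- the inclusion `L_{l+1} ⟶ L'_{l+1}` -/
  incl : ∀ l : ℕ, T.L (l + 1) ⟶ L' (l + 1)
  act'_incl : ∀ l : ℕ, 1 ≤ l → l < n → ∀ (V : E) (Y : (T.F (l + 1)).obj (op V))
    (s : (T.L (l + 1)).obj.obj (op V)),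
    act' (l + 1) V Y (Multiplicative.ofAdd ((incl l).hom.app (op V) s)) =
      T.act (l + 1) V Y (Multiplicative.ofAdd s)
  /-- the projection `L'_{l+1} ⟶ L_l` -/
  quot : ∀ l : ℕ, L' (l + 1) ⟶ T.L l
  mapAut_act' : ∀ (l : ℕ) (h₁ : 1 ≤ l) (h₂ : l < n) (V : E) (Y : (T.F (l + 1)).obj (op V))
    (s : (L' (l + 1)).obj.obj (op V)),
    (proj (T.p l h₁ h₂) V).mapAut Y (act' (l + 1) V Y (Multiplicative.ofAdd s)) =
      T.act l V ((proj (T.p l h₁ h₂) V).obj Y) (Multiplicative.ofAdd ((quot l).hom.app (op V) s))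

/-! ### Čech cochains -/

section Cech

variable {E : Type u} [Category.{v} E] [HasFiniteProducts E] {I : Type*} (U : I → E)

/-- `U_{i_1 … i_k}`, the fibre product of `U_{i_1}, …, U_{i_k}` over the final object. -/
noncomputable abbrev inter {k : ℕ} (i : Fin k → I) : E := ∏ᶜ fun b => U (i b)

/-- The projection `U_{i_1 … i_k} ⟶ U_{i_b}`. -/
noncomputable abbrev toMember {k : ℕ} (i : Fin k → I) (b : Fin k) : inter U i ⟶ U (i b) :=
  Pi.π (fun b => U (i b)) b

/-- The projection `U_{i_1 … i_k} ⟶ U_{i_b i_c}`. -/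
noncomputable abbrev toPair {k : ℕ} (i : Fin k → I) (b c : Fin k) :
    inter U i ⟶ U (i b) ⨯ U (i c) :=
  prod.lift (toMember U i b) (toMember U i c)

/-- The projection `U_{i_1 … i_k} ⟶ U_{i_θ(1) … i_θ(m)}`. -/
noncomputable abbrev reindex {k m : ℕ} (i : Fin k → I) (θ : Fin m → Fin k) :
    inter U i ⟶ inter U (i ∘ θ) :=
  Pi.lift fun b => toMember U i (θ b)

/-- The Čech `q`-cochains of the family `U` with values in the sheaf `L`: families indexed by
`q + 1` indices. -/
abbrev Cochain {J : GrothendieckTopology E} (L : Sheaf J AddCommGrpCat.{a}) (q : ℕ) :=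
  ∀ i : Fin (q + 1) → I, L.obj.obj (op (inter U i))

/-- The Čech boundary, with `b` counted from `0`:
`(∂c)_{i_0 … i_{q+1}} = ∑_b (-1)^b c_{i_0 … î_b … i_{q+1}}`. -/
noncomputable def cechBoundary {J : GrothendieckTopology E} {L : Sheaf J AddCommGrpCat.{a}}
    {q : ℕ} (c : Cochain U L q) : Cochain U L (q + 1) :=
  fun i => ∑ b : Fin (q + 2),
    ((-1 : ℤ) ^ (b : ℕ)) • L.obj.map (reindex U i b.succAbove).op (c (i ∘ b.succAbove))

end Cech

/-! ### Classifying cochains -/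

section Classifying

variable {E : Type u} [Category.{v} E] [HasFiniteProducts E] {J : GrothendieckTopology E} {n : ℕ}
  (T : GerbedTower.{u, v, w₁, w₂, t₁, t₂, g₁, g₂, a} J n) (A : ExtendedBand T)
  {I : Type*} (U : I → E)

variable {U} in
/-- The restriction to `U_{i_1 … i_k}` of the arrow `v_{i_b i_c}`, which goes from the restriction
of `u_{i_c}` to the restriction of `u_{i_b}`. -/
noncomputable def resArrow {F : Eᵒᵖ ⥤ Cat.{w₁, w₂}} (x : ∀ i : I, F.obj (op (U i)))
    (f : ∀ i j : I, (res F (prod.snd : U i ⨯ U j ⟶ U j)).obj (x j) ≅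
      (res F (prod.fst : U i ⨯ U j ⟶ U i)).obj (x i))
    {k : ℕ} (i : Fin k → I) (b c : Fin k) :
    (res F (toMember U i c)).obj (x (i c)) ≅ (res F (toMember U i b)).obj (x (i b)) :=
  eqToIso (res_comp_obj F (toPair U i b c) prod.snd _ (prod.lift_snd _ _) _).symm ≪≫
    (res F (toPair U i b c)).mapIso (f (i b) (i c)) ≪≫
    eqToIso (res_comp_obj F (toPair U i b c) prod.fst _ (prod.lift_fst _ _) _)

variable {U} in
/-- The automorphism `v_{i_3 i_1} v_{i_1 i_2} v_{i_2 i_3}` of the restriction of `u_{i_3}`. -/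
noncomputable def tripleArrow {F : Eᵒᵖ ⥤ Cat.{w₁, w₂}} (x : ∀ i : I, F.obj (op (U i)))
    (f : ∀ i j : I, (res F (prod.snd : U i ⨯ U j ⟶ U j)).obj (x j) ≅
      (res F (prod.fst : U i ⨯ U j ⟶ U i)).obj (x i))
    (i : Fin 3 → I) : Aut ((res F (toMember U i 2)).obj (x (i 2))) :=
  resArrow x f i 1 2 ≪≫ resArrow x f i 0 1 ≪≫ resArrow x f i 2 0

/-- The choices made above a cochain `c_{i_1 … i_{l+2}}` of automorphisms of the objects
`X_{i_1 … i_{l+2}}` of `F_l`: objects `u_{i_1 … i_{l+2}}` of `F_{l+1}` above them, and automorphisms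
`c*_{i_1 … i_{l+2}}` of these objects above `c_{i_1 … i_{l+2}}`, given as sections of `L'_{l+1}`. -/
structure LiftData {l : ℕ} (h₁ : 1 ≤ l) (h₂ : l < n)
    (X : ∀ i : Fin (l + 2) → I, (T.F l).obj (op (inter U i)))
    (c : Cochain U (T.L l) (l + 1)) where
  /-- the objects `u_{i_1 … i_{l+2}}` -/
  obj : ∀ i : Fin (l + 2) → I, (T.F (l + 1)).obj (op (inter U i))
  proj_obj : ∀ i : Fin (l + 2) → I, (proj (T.p l h₁ h₂) (inter U i)).obj (obj i) = X i
  /-- the lifts `c*_{i_1 … i_{l+2}}` -/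
  star : Cochain U (A.L' (l + 1)) (l + 1)
  star_above : ∀ i : Fin (l + 2) → I,
    (proj (T.p l h₁ h₂) (inter U i)).mapAut (obj i)
        (A.act' (l + 1) (inter U i) (obj i) (Multiplicative.ofAdd (star i))) =
      T.act l (inter U i) ((proj (T.p l h₁ h₂) (inter U i)).obj (obj i))
        (Multiplicative.ofAdd (c i))

variable {T A U}

/-- The objects `(u_{i_1 … i_{l+2}})^{i_{l+3}}` on which the next cochain acts. -/
noncomputable def LiftData.next {l : ℕ} {h₁ : 1 ≤ l} {h₂ : l < n}
    {X : ∀ i : Fin (l + 2) → I, (T.F l).obj (op (inter U i))} {c : Cochain U (T.L l) (l + 1)}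
    (D : LiftData T A U h₁ h₂ X c) (i : Fin (l + 3) → I) :
    (T.F (l + 1)).obj (op (inter U i)) :=
  (res (T.F (l + 1)) (reindex U i Fin.castSucc)).obj (D.obj (i ∘ Fin.castSucc))

/-- The alternating sum of the lifts in `L'_{l+1}`: it is
`c*_{i_2 i_3 i_4} - c*_{i_1 i_3 i_4} + c*_{i_1 i_2 i_4} - c*_{i_1 i_2 i_3}` for `l = 1`, and
`∑_{b=1}^{l+3} (-1)^b c*_{i_1 … î_b … i_{l+3}}` (with `b` counted from `1`) for `l ≥ 2`. -/
noncomputable def LiftData.altSum {l : ℕ} {h₁ : 1 ≤ l} {h₂ : l < n}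
    {X : ∀ i : Fin (l + 2) → I, (T.F l).obj (op (inter U i))} {c : Cochain U (T.L l) (l + 1)}
    (D : LiftData T A U h₁ h₂ X c) : Cochain U (A.L' (l + 1)) (l + 2) :=
  fun i => ∑ b : Fin (l + 3), ((-1 : ℤ) ^ (if l = 1 then (b : ℕ) else (b : ℕ) + 1)) •
    (A.L' (l + 1)).obj.map (reindex U i b.succAbove).op (D.star (i ∘ b.succAbove))

/-- The family `c'_{i_1 … i_{l+3}}` of sections of `L_{l+1}` is the alternating sum of the lifts:
both define the same automorphism of `(u_{i_1 … i_{l+2}})^{i_{l+3}}`. -/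
def LiftData.IsNext {l : ℕ} {h₁ : 1 ≤ l} {h₂ : l < n}
    {X : ∀ i : Fin (l + 2) → I, (T.F l).obj (op (inter U i))} {c : Cochain U (T.L l) (l + 1)}
    (D : LiftData T A U h₁ h₂ X c) (c' : Cochain U (T.L (l + 1)) (l + 2)) : Prop :=
  ∀ i : Fin (l + 3) → I,
    T.act (l + 1) (inter U i) (D.next i) (Multiplicative.ofAdd (c' i)) =
      A.act' (l + 1) (inter U i) (D.next i) (Multiplicative.ofAdd (D.altSum i))

variable (T A U)

/-- `IsClassifying T A U l X c`: for some choices, the cochains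
`c_{i_1 i_2 i_3}, …, c_{i_1 … i_{l+2}}` are defined, the last one is `c`, and `c_{i_1 … i_{l+2}}`
acts on the object `X_{i_1 … i_{l+2}}` of `F_l`. -/
inductive IsClassifying : ∀ l : ℕ, (∀ i : Fin (l + 2) → I, (T.F l).obj (op (inter U i))) →
    Cochain U (T.L l) (l + 1) → Prop
  /-- the cochain `c_{i_1 i_2 i_3} = v_{i_3 i_1} v_{i_1 i_2} v_{i_2 i_3}` of the gerbe `F_1` -/
  | base (hn : 1 ≤ n) (x : ∀ i : I, (T.F 1).obj (op (U i)))
      (f : ∀ i j : I, (res (T.F 1) (prod.snd : U i ⨯ U j ⟶ U j)).obj (x j) ≅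
        (res (T.F 1) (prod.fst : U i ⨯ U j ⟶ U i)).obj (x i))
      (c : Cochain U (T.L 1) 2)
      (hc : ∀ i : Fin 3 → I,
        T.act 1 (inter U i) ((res (T.F 1) (toMember U i 2)).obj (x (i 2)))
          (Multiplicative.ofAdd (c i)) = tripleArrow x f i) :
      IsClassifying 1 (fun i => (res (T.F 1) (toMember U i 2)).obj (x (i 2))) c
  | step {l : ℕ} (h₁ : 1 ≤ l) (h₂ : l < n)
      {X : ∀ i : Fin (l + 2) → I, (T.F l).obj (op (inter U i))} {c : Cochain U (T.L l) (l + 1)}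
      (h : IsClassifying l X c) (D : LiftData T A U h₁ h₂ X c)
      (c' : Cochain U (T.L (l + 1)) (l + 2)) (hc' : D.IsNext c') :
      IsClassifying (l + 1) D.next c'

end Classifying

end GerbedTowers

namespace GerbedTowers

/-! ### Automorphisms given by sections of the bands -/

section Automorphisms

variable {E : Type u} [Category.{v} E] {J : GrothendieckTopology E}

/-! Up to a global sign, the alternating sum is the Čech boundary `∂c*` in `L'_{l+1}` (`altSum_eq`).
The projection to `L_l` commutes with `∂` and sends `c*` to `c` (`quot_star`), so it sends the sum
to `±∂c`. For `l ≥ 2` this vanishes: `c` is itself the alternating sum of a lift one level below, so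
its image in `L'_l` is `±∂` of that lift. That image is killed by `∂`, and `L_l → L'_l` is injective
over the products concerned.

The sum therefore acts above identities of `F_l`. Such automorphisms live in the fibre gerbe, where
the band `L_{l+1}` gives every automorphism exactly once; this yields existence
(`exists_act_succ_eq`) and uniqueness (`act_succ_injective`). The resulting family is a cocycle by
the argument already applied to `c` (`LiftData.cechBoundary_eq_zero`). -/

theorem FibreGerbe.aut_bijective {F F' : Eᵒᵖ ⥤ Cat.{w₁, w₂}}
    {p : F' ⟶ F} {τ : TwoTopology.{u, v, w₁, w₂, t₁, t₂} F} {L : Sheaf J AddCommGrpCat.{a}}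
    {V : E} {X : F.obj (op V)}
    (G : FibreGerbe.{u, v, w₁, w₂, t₁, t₂, g₁, g₂, a} p τ L X) (Y : (proj p V).Fiber X) :
    Function.Bijective (G.aut Y) :=
  (G.fibre.fullyFaithfulFunctor.autMulEquivOfFullyFaithful Y).symm.bijective.comp
    ((G.isBand.bijective (τ.final X) (G.fibre.functor.obj Y)).comp
      (Multiplicative.ofAdd.bijective.comp G.sections.bijective))

theorem mapAut_injective {C D : Type*} [Category C] [Category D] (K : C ⥤ D) [K.Faithful] (X : C) :
    Function.Injective (K.mapAut X) :=
  K.mapIso_injective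

/-- An automorphism above an identity is an automorphism in the fibre. -/
theorem exists_mapAut_fiberInclusion_eq {C D : Type*} [Category C] [Category D] (K : C ⥤ D)
    {S : D} (Y : K.Fiber S) (b : Aut Y.1) (hb : K.mapAut Y.1 b = 1) :
    ∃ b' : Aut Y, Functor.Fiber.fiberInclusion.mapAut Y b' = b := by
  -- Taking `S` to be the image of `Y` itself makes lying over `𝟙 S` a plain equation in `D`.
  obtain ⟨Y, rfl⟩ := Y
  have h₁ : K.map b.hom = 𝟙 _ := congrArg Iso.hom hb
  have h₂ : K.map b.inv = 𝟙 _ := congrArg Iso.inv hb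
  have e₁ : K.IsHomLift (𝟙 (K.obj Y)) b.hom := h₁ ▸ inferInstance
  have e₂ : K.IsHomLift (𝟙 (K.obj Y)) b.inv := h₂ ▸ inferInstance
  exact ⟨⟨⟨b.hom, e₁⟩, ⟨b.inv, e₂⟩, Functor.Fiber.hom_ext b.hom_inv_id,
    Functor.Fiber.hom_ext b.inv_hom_id⟩, Iso.ext rfl⟩

variable {n : ℕ} (T : GerbedTower.{u, v, w₁, w₂, t₁, t₂, g₁, g₂, a} J n)

/-- The action factors through the automorphisms of `Y` in the fibre over its own image: the band is
bijective onto these, and the inclusion of the fibre is faithful. -/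
theorem GerbedTower.act_succ_injective {l : ℕ} (h₁ : 1 ≤ l) (h₂ : l < n) {V : E}
    (Y : (T.F (l + 1)).obj (op V)) : Function.Injective (T.act (l + 1) V Y) := by
  have h : (fun s => T.act (l + 1) V Y (Multiplicative.ofAdd s)) = _ :=
    funext fun s => T.act_eq l h₁ h₂ V _ ⟨Y, rfl⟩ s
  have hi : Function.Injective (fun s => T.act (l + 1) V Y (Multiplicative.ofAdd s)) := by
    rw [h]
    exact (mapAut_injective _ _).comp ((T.fibreGerbe l h₁ h₂ V _).aut_bijective _).injective
  exact fun s t hst => hi hst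

/-- The automorphisms of an object of `F_{l+1}` above an identity of `F_l` are given by sections
of the band. -/
theorem GerbedTower.exists_act_succ_eq {l : ℕ} (h₁ : 1 ≤ l) (h₂ : l < n) {V : E}
    (Y : (T.F (l + 1)).obj (op V)) (b : Aut Y) (hb : (proj (T.p l h₁ h₂) V).mapAut Y b = 1) :
    ∃ s : (T.L (l + 1)).obj.obj (op V), T.act (l + 1) V Y (Multiplicative.ofAdd s) = b := by
  let Z : (proj (T.p l h₁ h₂) V).Fiber ((proj (T.p l h₁ h₂) V).obj Y) := ⟨Y, rfl⟩
  obtain ⟨b', rfl⟩ := exists_mapAut_fiberInclusion_eq _ Z b hb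
  obtain ⟨s, rfl⟩ := ((T.fibreGerbe l h₁ h₂ V _).aut_bijective Z).surjective b'
  exact ⟨s, T.act_eq l h₁ h₂ V _ Z s⟩

variable {T} (A : ExtendedBand T)

/-- The faithful action of `L_{l+1}(V)` on `Y` factors through the inclusion. An object `Y` above
`V` is needed as a witness. -/
theorem ExtendedBand.incl_injective {l : ℕ} (h₁ : 1 ≤ l) (h₂ : l < n) {V : E}
    (Y : (T.F (l + 1)).obj (op V)) : Function.Injective ((A.incl l).hom.app (op V)) := by
  intro s t hst
  have h : T.act (l + 1) V Y (Multiplicative.ofAdd s) =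
      T.act (l + 1) V Y (Multiplicative.ofAdd t) := by
    rw [← A.act'_incl l h₁ h₂, ← A.act'_incl l h₁ h₂, hst]
  exact T.act_succ_injective h₁ h₂ Y h

end Automorphisms

/-! ### The Čech complex -/

section Cech

/-- Each term omits two positions in a given order. Omitting them in the other order gives the same
composite with the opposite sign, so the terms cancel in pairs. -/
theorem sum_neg_one_pow_smul_succAbove_comp {M : Type*} [AddCommGroup M] {q : ℕ}
    (Φ : (Fin (q + 1) → Fin (q + 3)) → M) :
    ∑ b : Fin (q + 3), ∑ d : Fin (q + 2),
      ((-1 : ℤ) ^ (b : ℕ)) • ((-1 : ℤ) ^ (d : ℕ)) • Φ (b.succAbove ∘ d.succAbove) = 0 := by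
  rw [← Fintype.sum_prod_type' (f := fun (b : Fin (q + 3)) (d : Fin (q + 2)) =>
    ((-1 : ℤ) ^ (b : ℕ)) • ((-1 : ℤ) ^ (d : ℕ)) • Φ (b.succAbove ∘ d.succAbove))]
  -- The pair `(b, d)` omits `b` and `b.succAbove d`; the involution omits `b.succAbove d` first. It
  -- has no fixed point because these positions differ.
  refine Finset.sum_involution (fun x _ => (x.1.succAbove x.2, x.2.predAbove x.1)) ?_ ?_ ?_ ?_
  · rintro ⟨b, d⟩ -
    have h : (b.succAbove d).succAbove ∘ (d.predAbove b).succAbove =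
        b.succAbove ∘ d.succAbove :=
      funext fun k => Fin.succAbove_succAbove_succAbove_predAbove b d k
    simp only [h, smul_smul, ← pow_add, Fin.neg_one_pow_succAbove_add_predAbove]
    simp
  · rintro ⟨b, d⟩ - - h
    exact Fin.succAbove_ne b d (congrArg Prod.fst h)
  · exact fun _ _ => Finset.mem_univ _
  · rintro ⟨b, d⟩ -
    exact Prod.ext (Fin.succAbove_succAbove_predAbove b d) (Fin.predAbove_predAbove_succAbove b d)

variable {E : Type u} [Category.{v} E] [HasFiniteProducts E] {I : Type*} (U : I → E)

theorem reindex_comp {k m r : ℕ} (i : Fin k → I) (θ : Fin m → Fin k) (η : Fin r → Fin m) :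
    reindex U i θ ≫ reindex U (i ∘ θ) η = reindex U i (θ ∘ η) :=
  Pi.hom_ext _ _ fun b => by
    rw [Category.assoc, Pi.lift_π, Pi.lift_π]
    exact (Pi.lift_π (fun d => toMember U i ((θ ∘ η) d)) b).symm

variable {J : GrothendieckTopology E} {L M : Sheaf J AddCommGrpCat.{a}} {q : ℕ}

theorem cechBoundary_cechBoundary (c : Cochain U L q) : cechBoundary U (cechBoundary U c) = 0 := by
  funext i
  refine Eq.trans ?_ (sum_neg_one_pow_smul_succAbove_comp
    fun θ => L.obj.map (reindex U i θ).op (c (i ∘ θ)))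
  refine Finset.sum_congr rfl fun b _ => ?_
  rw [cechBoundary, map_sum, Finset.smul_sum]
  refine Finset.sum_congr rfl fun d _ => ?_
  rw [map_zsmul, ← reindex_comp, op_comp, Functor.map_comp]
  rfl

theorem cechBoundary_zsmul (m : ℤ) (c : Cochain U L q) :
    cechBoundary U (m • c) = m • cechBoundary U c := by
  funext i
  simp only [cechBoundary, Pi.smul_apply, map_zsmul, Finset.smul_sum, smul_comm m]

theorem cechBoundary_map (φ : L ⟶ M) (c : Cochain U L q) (i : Fin (q + 2) → I) :
    cechBoundary U (fun j => φ.hom.app (op (inter U j)) (c j)) i =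
      φ.hom.app (op (inter U i)) (cechBoundary U c i) := by
  simp only [cechBoundary, map_sum, map_zsmul]
  refine Finset.sum_congr rfl fun b _ => congrArg _ ?_
  exact (ConcreteCategory.congr_hom (φ.hom.naturality (reindex U i b.succAbove).op) _).symm

end Cech

/-! ### The next classifying cochain -/

section Classifying

variable {E : Type u} [Category.{v} E] [HasFiniteProducts E] {J : GrothendieckTopology E} {n : ℕ}
  {T : GerbedTower.{u, v, w₁, w₂, t₁, t₂, g₁, g₂, a} J n} {A : ExtendedBand T}
  {I : Type*} {U : I → E}

namespace LiftData

variable {l : ℕ} {h₁ : 1 ≤ l} {h₂ : l < n}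
  {X : ∀ i : Fin (l + 2) → I, (T.F l).obj (op (inter U i))} {c : Cochain U (T.L l) (l + 1)}
  (D : LiftData T A U h₁ h₂ X c)

/-- For `l ≠ 1` the omitted index is counted from `1` in the sign, and from `0` in the Čech
boundary: hence the factor `-1`. -/
theorem altSum_eq :
    D.altSum = ((-1 : ℤ) ^ (if l = 1 then 0 else 1)) • cechBoundary U D.star := by
  funext i
  simp only [altSum, cechBoundary, Pi.smul_apply, Finset.smul_sum, smul_smul, ← pow_add]
  refine Finset.sum_congr rfl fun b _ => ?_
  split_ifs <;> simp [add_comm]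

/-- Since `L'_{l+1}` acts faithfully, equality of automorphisms becomes equality of sections, and
Čech calculus applies. -/
theorem isNext_iff (c' : Cochain U (T.L (l + 1)) (l + 2)) :
    D.IsNext c' ↔ (fun i => (A.incl l).hom.app (op (inter U i)) (c' i)) = D.altSum := by
  rw [funext_iff]
  refine forall_congr' fun i => ?_
  rw [← A.act'_incl l h₁ h₂]
  exact (A.injective l h₁ h₂ _ _).eq_iff.trans Multiplicative.ofAdd.injective.eq_iff

theorem cechBoundary_eq_zero {c' : Cochain U (T.L (l + 1)) (l + 2)} (h : D.IsNext c') :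
    cechBoundary U c' = 0 := by
  funext i
  -- A restriction of `D.next` supplies the object above `inter U i` that injectivity requires.
  apply A.incl_injective h₁ h₂ ((res (T.F (l + 1)) (reindex U i Fin.castSucc)).obj (D.next _))
  rw [← cechBoundary_map, (D.isNext_iff c').1 h, altSum_eq, cechBoundary_zsmul,
    cechBoundary_cechBoundary]
  simp

theorem isNext_unique {c₁ c₂ : Cochain U (T.L (l + 1)) (l + 2)} (e₁ : D.IsNext c₁)
    (e₂ : D.IsNext c₂) : c₁ = c₂ :=
  funext fun i => T.act_succ_injective h₁ h₂ (D.next i) ((e₁ i).trans (e₂ i).symm)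

/-- `star_above` only compares automorphisms; faithfulness of the action of `L_l` turns it into an
equality of sections. -/
theorem quot_star (hT : ∀ (V : E) (X : (T.F l).obj (op V)), Function.Injective (T.act l V X)) :
    (fun i => (A.quot l).hom.app (op (inter U i)) (D.star i)) = c :=
  funext fun i => hT _ _ ((A.mapAut_act' l h₁ h₂ _ (D.obj i) (D.star i)).symm.trans (D.star_above i))

/-- If the sections of `L_l` act faithfully and `c` is a cocycle, the next cochain exists. -/
theorem exists_isNext
    (hT : ∀ (V : E) (X : (T.F l).obj (op V)), Function.Injective (T.act l V X))
    (hc : cechBoundary U c = 0) : ∃ c' : Cochain U (T.L (l + 1)) (l + 2), D.IsNext c' := by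
  refine Classical.skolem.1 fun i => T.exists_act_succ_eq h₁ h₂ (D.next i) _ ?_
  -- The image in `L_l` is `±∂c`; once it vanishes, the automorphism lies above an identity.
  have h : (A.quot l).hom.app (op (inter U i)) (D.altSum i) = 0 := by
    rw [altSum_eq, Pi.smul_apply, map_zsmul, ← cechBoundary_map, D.quot_star hT, hc]
    simp
  rw [A.mapAut_act', h]
  exact map_one _

end LiftData

/-- The classifying cochains of degree at least `3` are cocycles. -/
theorem IsClassifying.cechBoundary_eq_zero {l : ℕ}
    {X : ∀ i : Fin (l + 2) → I, (T.F l).obj (op (inter U i))} {c : Cochain U (T.L l) (l + 1)}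
    (hc : IsClassifying T A U l X c) (hl : 2 ≤ l) : cechBoundary U c = 0 := by
  cases hc with
  | base => omega
  | step _ _ _ D _ hc' => exact D.cechBoundary_eq_zero hc'

end Classifying

end GerbedTowers

theorem proposition4p2p2 {E : Type u} [Category.{v} E] [HasFiniteProducts E]
    {J : GrothendieckTopology E} {n : ℕ}
    (T : GerbedTowers.GerbedTower.{u, v, w₁, w₂, t₁, t₂, g₁, g₂, a} J n)
    (A : GerbedTowers.ExtendedBand T) {I : Type*} (U : I → E) (hU : J.CoversTop U)
    {l : ℕ} (hl : 2 ≤ l) (hn : l < n)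
    (X : ∀ i : Fin (l + 2) → I, (T.F l).obj (op (GerbedTowers.inter U i)))
    (c : GerbedTowers.Cochain U (T.L l) (l + 1))
    (hc : GerbedTowers.IsClassifying T A U l X c)
    (D : GerbedTowers.LiftData T A U (one_le_two.trans hl) hn X c) :
    (∃! c' : GerbedTowers.Cochain U (T.L (l + 1)) (l + 2), D.IsNext c') ∧
      ∀ c' : GerbedTowers.Cochain U (T.L (l + 1)) (l + 2), D.IsNext c' →
        GerbedTowers.cechBoundary U c' = 0 := by
  obtain ⟨c', hc'⟩ := D.exists_isNext (fun V X => by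
    -- With `l = m + 1` and `m ≥ 1`, `F_l` is fibred in gerbes over `F_m`, so `L_l` acts faithfully.
    obtain ⟨m, rfl⟩ := Nat.exists_eq_add_of_le' hl
    exact T.act_succ_injective (by omega) (by omega) X) (hc.cechBoundary_eq_zero hl)
  exact ⟨⟨c', hc', fun _ h => D.isNext_unique h hc'⟩, fun _ h => D.cechBoundary_eq_zero h⟩
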